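/- Let $(Y,\rho_Y)$ be a non-empty complete separable metric space with its Borel $\sigma$-field, let $I$ be a non-empty finite set with the discrete topology, and put $X:=Y\times I$, $\bar X:=X\times\mathbb R_+$, where $\mathbb R_+=[0,\infty)$. Suppose we are given the following data. - For each $i\in I$, a jointly continuous semiflow $S_i:\mathbb R_+\times Y\to Y$, i.e. $S_i(0,y)=y$ and $S_i(s,S_i(t,y))=S_i(s+t,y)$ for all $s,t\in\mathbb R_+$, $y\in Y$. - Continuous maps $\pi_{ij}:Y\to[0,1]$, $i,j\in I$, with $\sum_{j\in I}\pi_{ij}(y)=1$ for all $i\in I$, $y\in Y$. - A continuous function $\lambda:Y\to(0,\infty)$ with $\underline\lambda\le\lambda\le\bar\lambda$ for some constants $\underline\lambda,\bar\lambda>0$; write $\Lambda(y,i,t):=\int_0^t\lambda(S_i(h,y))\,dh$. - A stochastic kernel $J$ on $Y$ such that, for every bounded continuous $g:Y\times\mathbb R_+\to\mathbb R$, the map $Y\times\mathbb R_+\ni(y,t)\mapsto\int_Y g(u,t)\,J(y,du)$ is jointly continuous. Let $\bar P$ be the stochastic kernel on $\bar X$ given by $$\bar P((y,i,s),\bar A)=\int_0^\infty\lambda(S_i(t,y))e^{-\Lambda(y,i,t)}\int_Y\sum_{j\in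 I}\pi_{ij}(u)\mathbf 1_{\bar A}(u,j,s+t)\,J(S_i(t,y),du)\,dt ,$$ and let $P$ be the stochastic kernel on $X$ given by $P((y,i),A):=\bar P((y,i,0),A\times\mathbb R_+)$. For $x\in X$ let $\mathbb P_{(x,0)}$ be the law of the canonical Markov chain $(Y_n,\xi_n,\tau_n)_{n\in\mathbb N_0}$ on $\bar X$ with transition law $\bar P$ and initial state $(x,0)$. Define the process $\Psi$ by $$\Psi(t)=\bigl(S_{\xi_n}(t-\tau_n,Y_n),\,\xi_n\bigr)\quad\text{whenever } t\in[\tau_n,\tau_{n+1}),\ n\in\mathbb N_0$$ (this defines $\Psi(t)$ for all $t\ge 0$ almost surely, since $\tau_n\uparrow\infty$ almost surely), and let $\{P_t\}_{t\in\mathbb R_+}$ be its transition semigroup, $P_t(x,A):=\mathbb P_{(x,0)}(\Psi(t)\in A)$ for $x\in X$ and Borel $A\subset X$. Then there is exactly one Borel probability measure $\mu$ on $X$ with $\mu P_t=\mu$ for all $t\in\mathbb R_+$ if and only if there is exactly one Borel probability measure $\nu$ on $X$ with $\nu P=\nu$. Here $\mu K(A):=\int_X K(x,A)\,\mu(dx)$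 for a kernel $K$ on $X$. -/

import Mathlib

open MeasureTheory ProbabilityTheory Set
open scoped NNReal ENNReal

noncomputable section

/-- The data of the model on `X = Y × I`: semiflows `S i`, switching probabilities `sw i j`
(usually denoted `π_{ij}`), a jump intensity `lam` bounded and bounded away from `0`, and a
stochastic kernel `J` on `Y`. The time half-line is `ℝ≥0 = [0, ∞)`. -/
structure PDMPModel (Y : Type*) (I : Type*) [TopologicalSpace Y] [MeasurableSpace Y]
    [Fintype I] where
  /-- the semiflows, `S i t y` -/
  S : I → ℝ≥0 → Y → Y
  continuous_S : ∀ i, Continuous fun p : ℝ≥0 × Y => S i p.1 p.2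
  S_zero : ∀ i y, S i 0 y = y
  S_add : ∀ i s t y, S i s (S i t y) = S i (s + t) y
  /-- the switching probabilities, `sw i j y` -/
  sw : I → I → Y → ℝ
  continuous_sw : ∀ i j, Continuous (sw i j)
  sw_mem : ∀ i j y, sw i j y ∈ Icc (0 : ℝ) 1
  sum_sw : ∀ i y, ∑ j, sw i j y = 1
  /-- the jump intensity -/
  lam : Y → ℝ
  continuous_lam : Continuous lam
  lam_lower : ∃ a : ℝ, 0 < a ∧ ∀ y, a ≤ lam y
  lam_upper : ∃ b : ℝ, ∀ y, lam y ≤ b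
  /-- the stochastic kernel of the jumps -/
  J : Kernel Y Y
  isMarkov_J : IsMarkovKernel J

set_option linter.unusedSectionVars false

namespace PDMPModel

variable {Y I : Type*} [TopologicalSpace Y] [PolishSpace Y] [MeasurableSpace Y] [BorelSpace Y]
  [Fintype I] [MeasurableSpace I] [DiscreteMeasurableSpace I]

instance (M : PDMPModel Y I) : IsMarkovKernel M.J := M.isMarkov_J

lemma lam_pos (M : PDMPModel Y I) (y : Y) : 0 < M.lam y := by
  obtain ⟨a, ha, h⟩ := M.lam_lower
  exact ha.trans_le (h y)

/-- The flow on `X` between jumps: `(y, i)` is moved to `(S i t y, i)`. -/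
def flow (M : PDMPModel Y I) (t : ℝ≥0) (x : Y × I) : Y × I := (M.S x.2 t x.1, x.2)

/-- The cumulated intensity `Λ(y, i, t) = ∫₀ᵗ λ(S i h y) dh` (used for `t ≥ 0`). -/
def Lam (M : PDMPModel Y I) (x : Y × I) (t : ℝ) : ℝ :=
  ∫ h in (0 : ℝ)..t, M.lam (M.S x.2 h.toNNReal x.1)

/-- The density `λ(S i t y) exp (-Λ(y, i, t))` of the waiting time for a jump. -/
def waitDensity (M : PDMPModel Y I) (x : Y × I) (t : ℝ) : ℝ≥0∞ :=
  ENNReal.ofReal (M.lam (M.S x.2 t.toNNReal x.1) * Real.exp (-M.Lam x t))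

lemma measurable_flow (M : PDMPModel Y I) :
    Measurable fun p : ℝ≥0 × (Y × I) => M.flow p.1 p.2 := by
  have h : Measurable fun q : (ℝ≥0 × Y) × I => M.S q.2 q.1.1 q.1.2 :=
    measurable_from_prod_countable_left fun i => (M.continuous_S i).measurable
  have h' : Measurable fun p : ℝ≥0 × (Y × I) => M.S p.2.2 p.1 p.2.1 :=
    h.comp (f := fun p : ℝ≥0 × (Y × I) => ((p.1, p.2.1), p.2.2)) (by fun_prop)
  exact h'.prodMk (by fun_prop)

lemma measurable_waitDensity (M : PDMPModel Y I) :
    Measurable (Function.uncurry M.waitDensity) := by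
  have key : Measurable fun q : (Y × ℝ) × I => M.waitDensity (q.1.1, q.2) q.1.2 := by
    refine measurable_from_prod_countable_left fun i => Continuous.measurable ?_
    have hc : Continuous fun p : Y × ℝ => M.lam (M.S i p.2.toNNReal p.1) :=
      M.continuous_lam.comp ((M.continuous_S i).comp
        ((continuous_real_toNNReal.comp continuous_snd).prodMk continuous_fst))
    have hL : Continuous fun p : Y × ℝ => M.Lam (p.1, i) p.2 := by
      have hf : Continuous (Function.uncurry
          fun (p : Y × ℝ) (h : ℝ) => M.lam (M.S i h.toNNReal p.1)) :=
        hc.comp (f := fun r : (Y × ℝ) × ℝ => (r.1.1, r.2)) (by fun_prop)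
      exact intervalIntegral.continuous_parametric_intervalIntegral_of_continuous hf
        continuous_snd
    exact ENNReal.continuous_ofReal.comp (hc.mul (Real.continuous_exp.comp hL.neg))
  exact key.comp (f := fun p : (Y × I) × ℝ => ((p.1.1, p.2), p.1.2)) (by fun_prop)

lemma lintegral_waitDensity (M : PDMPModel Y I) (x : Y × I) :
    ∫⁻ t in Ioi (0 : ℝ), M.waitDensity x t = 1 := by
  obtain ⟨a, ha, hla⟩ := M.lam_lower
  set f : ℝ → ℝ := fun h => M.lam (M.S x.2 h.toNNReal x.1) with hfdef
  have hf : Continuous f := M.continuous_lam.comp ((M.continuous_S x.2).comp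
    (continuous_real_toNNReal.prodMk continuous_const))
  have hL : ∀ t, HasDerivAt (M.Lam x) (f t) t := fun t =>
    intervalIntegral.integral_hasDerivAt_right (hf.intervalIntegrable _ _)
      (hf.stronglyMeasurableAtFilter _ _) hf.continuousAt
  have hd : ∀ t ∈ Ici (0 : ℝ), HasDerivAt (fun t => -Real.exp (-M.Lam x t))
      (f t * Real.exp (-M.Lam x t)) t := fun t _ => by
    have h := (hL t).neg.exp.neg
    simp only [Pi.neg_apply, mul_neg, neg_neg] at h
    rw [mul_comm]
    exact h
  have hpos : ∀ t ∈ Ioi (0 : ℝ), 0 ≤ f t * Real.exp (-M.Lam x t) := fun t _ =>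
    mul_nonneg (M.lam_pos _).le (Real.exp_pos _).le
  have hlow : ∀ t : ℝ, 0 ≤ t → a * t ≤ M.Lam x t := fun t ht => by
    have := intervalIntegral.integral_mono_on ht
      (intervalIntegrable_const (c := a) (μ := volume)) (hf.intervalIntegrable 0 t)
      (fun s _ => hla _)
    rw [intervalIntegral.integral_const, sub_zero, smul_eq_mul, mul_comm] at this
    exact this
  have hLtop : Filter.Tendsto (M.Lam x) Filter.atTop Filter.atTop :=
    Filter.tendsto_atTop_mono' _
      ((Filter.eventually_ge_atTop 0).mono hlow) (Filter.tendsto_id.const_mul_atTop ha)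
  have hlim : Filter.Tendsto (fun t => -Real.exp (-M.Lam x t)) Filter.atTop (nhds 0) := by
    have h := (Real.tendsto_exp_atBot.comp
      (Filter.tendsto_neg_atTop_atBot.comp hLtop)).neg
    rw [neg_zero] at h
    exact h
  have hint := integrableOn_Ioi_deriv_of_nonneg' hd hpos hlim
  have hval := integral_Ioi_of_hasDerivAt_of_nonneg' hd hpos hlim
  have h0 : M.Lam x 0 = 0 := by simp [Lam]
  rw [h0] at hval
  have hof := ofReal_integral_eq_lintegral_ofReal hint
    ((ae_restrict_iff' measurableSet_Ioi).2 (Filter.Eventually.of_forall hpos))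
  rw [hval] at hof
  simpa [waitDensity, hfdef] using hof.symm

/-- The law of the waiting time for the next jump, from the post-jump location `x`. -/
def wait (M : PDMPModel Y I) : Kernel (Y × I) ℝ≥0 :=
  ((Kernel.const (Y × I) (volume.restrict (Ioi (0 : ℝ)))).withDensity M.waitDensity).map
    Real.toNNReal

instance (M : PDMPModel Y I) : IsMarkovKernel M.wait := by
  have : IsMarkovKernel ((Kernel.const (Y × I)
      (volume.restrict (Ioi (0 : ℝ)))).withDensity M.waitDensity) := by
    refine ⟨fun x => ⟨?_⟩⟩
    rw [Kernel.withDensity_apply' _ M.measurable_waitDensity]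
    simpa using M.lintegral_waitDensity x
  exact Kernel.IsMarkovKernel.map _ measurable_real_toNNReal

/-- The law `∑ j, π_{ij}(u) δ_j` of the new index, given the former index `i` and the
new location `u`. -/
def switch (M : PDMPModel Y I) : Kernel (I × Y) I :=
  (Kernel.const (I × Y) Measure.count).withDensity fun p j => ENNReal.ofReal (M.sw p.1 j p.2)

lemma measurable_sw (M : PDMPModel Y I) :
    Measurable (Function.uncurry fun (p : I × Y) (j : I) => ENNReal.ofReal (M.sw p.1 j p.2)) := by
  have h : Measurable fun q : Y × (I × I) => ENNReal.ofReal (M.sw q.2.1 q.2.2 q.1) :=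
    measurable_from_prod_countable_left fun ij =>
      ENNReal.measurable_ofReal.comp (M.continuous_sw ij.1 ij.2).measurable
  exact h.comp (f := fun p : (I × Y) × I => (p.1.2, (p.1.1, p.2))) (by fun_prop)

instance (M : PDMPModel Y I) : IsMarkovKernel M.switch := by
  refine ⟨fun p => ⟨?_⟩⟩
  rw [switch, Kernel.withDensity_apply' _ M.measurable_sw]
  simp only [Kernel.const_apply, Measure.restrict_univ, lintegral_count, tsum_fintype]
  rw [← ENNReal.ofReal_sum_of_nonneg fun j _ => (M.sw_mem _ j _).1, M.sum_sw]
  simp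

/-- The law of the post-jump location, given the pre-jump location `(y, i)`:
`W((y, i), A) = ∫ ∑ j, π_{ij}(u) 1_A(u, j) J(y, du)`. -/
def W (M : PDMPModel Y I) : Kernel (Y × I) (Y × I) :=
  (M.J.comap Prod.fst measurable_fst) ⊗ₖ
    (M.switch.comap (fun p : (Y × I) × Y => (p.1.2, p.2)) (by fun_prop))

instance (M : PDMPModel Y I) : IsMarkovKernel M.W := by
  unfold W; infer_instance

/-- The joint law of the waiting time for the next jump and of the next post-jump location. -/
def step (M : PDMPModel Y I) : Kernel (Y × I) (ℝ≥0 × (Y × I)) :=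
  M.wait ⊗ₖ (M.W.comap (fun p : (Y × I) × ℝ≥0 => M.flow p.2 p.1)
    (M.measurable_flow.comp measurable_swap))

instance (M : PDMPModel Y I) : IsMarkovKernel M.step := by
  unfold step; infer_instance

/-- The transition law `P̄` on `X × [0, ∞)` of the chain of post-jump locations and jump times:
from `(x, s)`, draw `(t, x')` from `step x` and go to `(x', s + t)`. -/
def barP (M : PDMPModel Y I) : Kernel ((Y × I) × ℝ≥0) ((Y × I) × ℝ≥0) :=
  ((Kernel.deterministic (fun q : (Y × I) × ℝ≥0 => q.2) measurable_snd) ×ₖ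
    (M.step.comap (fun q : (Y × I) × ℝ≥0 => q.1) measurable_fst)).map
      fun r : ℝ≥0 × (ℝ≥0 × (Y × I)) => (r.2.2, r.1 + r.2.1)

instance (M : PDMPModel Y I) : IsMarkovKernel M.barP :=
  Kernel.IsMarkovKernel.map _ (by fun_prop)

/-- The explicit formula for `P̄`. -/
lemma barP_apply (M : PDMPModel Y I) (y : Y) (i : I) (s : ℝ≥0) {A : Set ((Y × I) × ℝ≥0)}
    (hA : MeasurableSet A) :
    M.barP ((y, i), s) A = ∫⁻ t in Ioi (0 : ℝ),
      ENNReal.ofReal (M.lam (M.S i t.toNNReal y) * Real.exp (-M.Lam (y, i) t)) *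
        ∫⁻ u, ∑ j, ENNReal.ofReal (M.sw i j u) * A.indicator 1 ((u, j), s + t.toNNReal)
          ∂(M.J (M.S i t.toNNReal y)) := by
  have hg : Measurable fun r : ℝ≥0 × (ℝ≥0 × (Y × I)) => (r.2.2, r.1 + r.2.1) := by fun_prop
  have hF : Measurable (A.indicator (1 : (Y × I) × ℝ≥0 → ℝ≥0∞)) := measurable_one.indicator hA
  have hF' : Measurable fun r : ℝ≥0 × (ℝ≥0 × (Y × I)) =>
      A.indicator (1 : (Y × I) × ℝ≥0 → ℝ≥0∞) (r.2.2, r.1 + r.2.1) := hF.comp hg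
  have hF2 : Measurable fun r : ℝ≥0 × (Y × I) =>
      A.indicator (1 : (Y × I) × ℝ≥0 → ℝ≥0∞) (r.2, s + r.1) :=
    hF.comp (f := fun r : ℝ≥0 × (Y × I) => (r.2, s + r.1)) (by fun_prop)
  have hW : ∀ (x : Y × I) (f : Y × I → ℝ≥0∞), Measurable f →
      ∫⁻ z, f z ∂(M.W x) = ∫⁻ u, ∑ j, ENNReal.ofReal (M.sw x.2 j u) * f (u, j) ∂(M.J x.1) := by
    intro x f hf
    rw [W, Kernel.lintegral_compProd _ _ _ hf, Kernel.comap_apply]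
    refine lintegral_congr fun u => ?_
    rw [Kernel.comap_apply, switch, Kernel.lintegral_withDensity _ M.measurable_sw _
      (by exact hf.comp measurable_prodMk_left), Kernel.const_apply, lintegral_count, tsum_fintype]
  have hK : Measurable fun t : ℝ≥0 => ∫⁻ z, A.indicator (1 : (Y × I) × ℝ≥0 → ℝ≥0∞) (z, s + t)
      ∂(M.W (M.flow t (y, i))) := by
    have := Measurable.lintegral_kernel_prod_right' (κ := M.W.comap (fun t : ℝ≥0 =>
      M.flow t (y, i)) (M.measurable_flow.comp measurable_prodMk_right)) hF2
    exact this
  rw [← lintegral_indicator_one hA, barP, Kernel.map_apply _ hg, lintegral_map hF hg,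
    Kernel.lintegral_prod _ _ _ hF', Kernel.lintegral_deterministic' _
      (by exact Measurable.lintegral_prod_right' hF'), Kernel.comap_apply, step,
    Kernel.lintegral_compProd _ _ _ hF2, wait, Kernel.map_apply _ measurable_real_toNNReal]
  simp only [Kernel.comap_apply]
  rw [lintegral_map hK measurable_real_toNNReal, Kernel.lintegral_withDensity _
    M.measurable_waitDensity _ (by exact hK.comp measurable_real_toNNReal), Kernel.const_apply]
  refine lintegral_congr fun t => ?_
  rw [hW _ _ (by exact hF.comp (f := fun z : Y × I => (z, s + t.toNNReal)) (by fun_prop))]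
  rfl

/-- The transition law of the chain of post-jump locations, `P((y, i), A) = P̄((y, i, 0), A × ℝ₊)`. -/
def P (M : PDMPModel Y I) : Kernel (Y × I) (Y × I) :=
  (M.barP.comap (fun x : Y × I => (x, (0 : ℝ≥0))) (by fun_prop)).map Prod.fst

/-- The law `ℙ_{(x, 0)}`, on the coordinate space, of the canonical Markov chain
`(Y_n, ξ_n, τ_n)_{n ∈ ℕ}` with transition law `P̄` started at `(x, 0)`. -/
def pathLaw (M : PDMPModel Y I) : Kernel (Y × I) (ℕ → (Y × I) × ℝ≥0) :=
  (Kernel.traj (X := fun _ => (Y × I) × ℝ≥0)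
    (fun n => M.barP.comap (fun h : (Finset.Iic n → (Y × I) × ℝ≥0) =>
      h ⟨n, Finset.mem_Iic.2 le_rfl⟩) (measurable_pi_apply _)) 0).comap
    (fun x _ => (x, (0 : ℝ≥0))) (by fun_prop)

instance (M : PDMPModel Y I) : IsMarkovKernel M.pathLaw := by
  unfold pathLaw; infer_instance

open Classical in
/-- The process `Ψ(t)`, as a function of the trajectory `ω = (Y_n, ξ_n, τ_n)_{n ∈ ℕ}`:
`Ψ(t) = (S_{ξ_n}(t - τ_n, Y_n), ξ_n)` for the `n` with `τ_n ≤ t < τ_{n+1}`. Off the almost sure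
event where such an `n` exists, the value is the initial state. -/
def Psi (M : PDMPModel Y I) (t : ℝ≥0) (ω : ℕ → (Y × I) × ℝ≥0) : Y × I :=
  if h : ∃ n, (ω n).2 ≤ t ∧ t < (ω (n + 1)).2 then
    M.flow (t - (ω (Nat.find h)).2) (ω (Nat.find h)).1
  else (ω 0).1

lemma measurable_Psi (M : PDMPModel Y I) (t : ℝ≥0) : Measurable (M.Psi t) := by
  classical
  have hm : ∀ n, MeasurableSet {ω : ℕ → (Y × I) × ℝ≥0 | (ω n).2 ≤ t ∧ t < (ω (n + 1)).2} :=
    fun n => (measurableSet_le (by fun_prop) measurable_const).inter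
      (measurableSet_lt measurable_const (by fun_prop))
  have hE : MeasurableSet {ω : ℕ → (Y × I) × ℝ≥0 | ∃ n, (ω n).2 ≤ t ∧ t < (ω (n + 1)).2} := by
    rw [ofPred_exists]
    exact MeasurableSet.iUnion hm
  refine Measurable.dite (s := {ω : ℕ → (Y × I) × ℝ≥0 | ∃ n, (ω n).2 ≤ t ∧ t < (ω (n + 1)).2})
    (f := fun ω => M.flow (t - (ω.1 (Nat.find ω.2)).2) (ω.1 (Nat.find ω.2)).1)
    (g := fun ω => (ω.1 0).1) ?_
    ((measurable_pi_apply 0).comp measurable_subtype_coe).fst hE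
  have hfind : Measurable fun ω : {ω : ℕ → (Y × I) × ℝ≥0 |
      ∃ n, (ω n).2 ≤ t ∧ t < (ω (n + 1)).2} => Nat.find ω.2 :=
    measurable_find (fun ω => ω.2) fun n => measurable_subtype_coe (hm n)
  have hev : Measurable fun q : (ℕ → (Y × I) × ℝ≥0) × ℕ => q.1 q.2 :=
    measurable_from_prod_countable_left fun n => measurable_pi_apply n
  have h := hev.comp (measurable_subtype_coe.prodMk hfind)
  exact M.measurable_flow.comp ((measurable_const.sub h.snd).prodMk h.fst)

/-- The transition semigroup of `Ψ`: `P_t(x, A) = ℙ_{(x, 0)}(Ψ(t) ∈ A)`. -/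
def semigroup (M : PDMPModel Y I) (t : ℝ≥0) : Kernel (Y × I) (Y × I) :=
  M.pathLaw.map (M.Psi t)

instance (M : PDMPModel Y I) (t : ℝ≥0) : IsMarkovKernel (M.semigroup t) :=
  Kernel.IsMarkovKernel.map _ (M.measurable_Psi t)

/-- The strengthened Feller property of `J`: for every bounded continuous `g` on `Y × [0, ∞)`, the
map `(y, t) ↦ ∫ g(u, t) J(y, du)` is jointly continuous. -/
def JointFeller (M : PDMPModel Y I) : Prop :=
  ∀ g : BoundedContinuousFunction (Y × ℝ≥0) ℝ,
    Continuous fun p : Y × ℝ≥0 => ∫ u, g (u, p.2) ∂(M.J p.1)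

end PDMPModel

end

noncomputable section

set_option linter.unusedSectionVars false

/-! Let K_t be the semigroup of the flow killed at its first jump (`killed`), G = ∫₀^∞ K_t dt its
`potential`, and λW the operator `jumpRate`. The waiting time has density λ exp(-Λ), so P = G λW.
The maps μ ↦ μλW (`jumpMeasure`) and ν ↦ νG are shown to be mutually inverse between the finite
measures invariant under the semigroup and those invariant under P. Both are homogeneous and
preserve finiteness because λ is bounded above and away from 0. They do not preserve total mass, so
uniqueness is transferred by normalising.

The bridge is the balance equation μf = μK_t f + ∫₀ᵗ μλW K_{t-v} f dv (`IsBalanced`). Splitting P_t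
by the number of jumps and conditioning on the last one (`lintegral_semigroup`, `nJumps_succ`) gives
P_t = K_t + ∫₀ᵗ P_v λW K_{t-v} dv, so invariance implies balance. Conversely, iterating balance
gives μP_t ≤ μ, and equal finite masses force equality.

If ν = νP and μ = νG, then μλW = νP = ν, and balance is the splitting of ∫₀^∞ νK_w f dw at w = t. If
μ is balanced, t → ∞ kills the first term and leaves μ = (μλW)G; applying λW shows that μλW is
P-invariant. -/

/-- A homogeneous bijective correspondence between the finite measures satisfying `p` and those
satisfying `q` carries over unique existence of probability measures. -/
lemma existsUnique_isProbabilityMeasure_of_correspondence {α β : Type*} [MeasurableSpace α]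
    [MeasurableSpace β] {p : Measure α → Prop} {q : Measure β → Prop}
    {F : Measure α → Measure β} {G : Measure β → Measure α}
    (hq : ∀ (c : ℝ≥0∞) (ν : Measure β), q ν → q (c • ν))
    (hp : ∀ (c : ℝ≥0∞) (μ : Measure α), p μ → p (c • μ))
    (hF : ∀ (c : ℝ≥0∞) (μ : Measure α), F (c • μ) = c • F μ)
    (hG : ∀ (c : ℝ≥0∞) (ν : Measure β), G (c • ν) = c • G ν)
    (hpF : ∀ μ : Measure α, IsFiniteMeasure μ → p μ →
      IsFiniteMeasure (F μ) ∧ q (F μ) ∧ G (F μ) = μ)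
    (hqG : ∀ ν : Measure β, IsFiniteMeasure ν → q ν →
      IsFiniteMeasure (G ν) ∧ p (G ν) ∧ F (G ν) = ν)
    (h : ∃! μ : Measure α, IsProbabilityMeasure μ ∧ p μ) :
    ∃! ν : Measure β, IsProbabilityMeasure ν ∧ q ν := by
  obtain ⟨μ, ⟨hμ, hpμ⟩, huniq⟩ := h
  obtain ⟨hfin, hqF, hGF⟩ := hpF μ inferInstance hpμ
  have hF0 : F 0 = 0 := by simpa using hF 0 0
  have hG0 : G 0 = 0 := by simpa using hG 0 0
  -- If `F μ` vanished, so would `G (F μ) = μ`; homogeneity at `c = 0` supplies `G 0 = 0`.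
  have hne : F μ univ ≠ 0 := fun h0 => by
    rw [Measure.measure_univ_eq_zero.1 h0, hG0] at hGF
    exact IsProbabilityMeasure.ne_zero μ hGF.symm
  refine ⟨(F μ univ)⁻¹ • F μ, ⟨⟨?_⟩, hq _ _ hqF⟩, ?_⟩
  · rw [Measure.smul_apply, smul_eq_mul, ENNReal.inv_mul_cancel hne (measure_ne_top _ _)]
  · rintro ν ⟨hν, hqν⟩
    obtain ⟨hfin', hpG, hFG⟩ := hqG ν inferInstance hqν
    have hne' : G ν univ ≠ 0 := fun h0 => by
      rw [Measure.measure_univ_eq_zero.1 h0, hF0] at hFG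
      exact IsProbabilityMeasure.ne_zero ν hFG.symm
    have h1 := huniq ((G ν univ)⁻¹ • G ν) ⟨⟨by rw [Measure.smul_apply, smul_eq_mul,
      ENNReal.inv_mul_cancel hne' (measure_ne_top _ _)]⟩, hp _ _ hpG⟩
    -- Applying `F` to the normalised `G ν`, which is `μ`, recovers `ν` up to a factor; comparing
    -- total masses then identifies that factor.
    have h2 : F μ = (G ν univ)⁻¹ • ν := by rw [← h1, hF, hFG]
    have h3 : F μ univ = (G ν univ)⁻¹ := by rw [h2]; simp
    rw [h3, h2, smul_smul, inv_inv, ENNReal.mul_inv_cancel hne' (measure_ne_top _ _), one_smul]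

namespace PDMPModel

variable {Y I : Type*} [TopologicalSpace Y] [PolishSpace Y] [MeasurableSpace Y] [BorelSpace Y]
  [Fintype I] [MeasurableSpace I] [DiscreteMeasurableSpace I]

/-! ### The killed flow -/

/-- The semigroup of the flow killed at the first jump, extended by `0` to negative times:
`killed t f x = exp (-Λ(x, t)) f (S t x)` for `0 ≤ t`. -/
def killed (M : PDMPModel Y I) (t : ℝ) (f : Y × I → ℝ≥0∞) (x : Y × I) : ℝ≥0∞ :=
  if 0 ≤ t then ENNReal.ofReal (Real.exp (-M.Lam x t)) * f (M.flow t.toNNReal x) else 0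

/-- The rate at which jumps out of `x` feed the function `f`. -/
def jumpRate (M : PDMPModel Y I) (f : Y × I → ℝ≥0∞) (x : Y × I) : ℝ≥0∞ :=
  ENNReal.ofReal (M.lam x.1) * ∫⁻ z, f z ∂(M.W x)

lemma continuous_lam_flow (M : PDMPModel Y I) (x : Y × I) :
    Continuous fun h : ℝ => M.lam (M.S x.2 h.toNNReal x.1) :=
  M.continuous_lam.comp ((M.continuous_S x.2).comp
    (continuous_real_toNNReal.prodMk continuous_const))

lemma measurable_Lam (M : PDMPModel Y I) : Measurable fun p : (Y × I) × ℝ => M.Lam p.1 p.2 := by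
  have key : Measurable fun q : (Y × ℝ) × I => M.Lam (q.1.1, q.2) q.1.2 := by
    refine measurable_from_prod_countable_left fun i => Continuous.measurable ?_
    have hf : Continuous (Function.uncurry
        fun (p : Y × ℝ) (h : ℝ) => M.lam (M.S i h.toNNReal p.1)) :=
      M.continuous_lam.comp ((M.continuous_S i).comp
        ((continuous_real_toNNReal.comp continuous_snd).prodMk continuous_fst.fst))
    exact intervalIntegral.continuous_parametric_intervalIntegral_of_continuous hf continuous_snd
  exact key.comp (f := fun p : (Y × I) × ℝ => ((p.1.1, p.2), p.1.2)) (by fun_prop)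

lemma measurable_killed (M : PDMPModel Y I) {α : Type*} [MeasurableSpace α] {t : α → ℝ}
    {f : α → Y × I → ℝ≥0∞} {x : α → Y × I} (ht : Measurable t)
    (hf : Measurable (Function.uncurry f)) (hx : Measurable x) :
    Measurable fun a => M.killed (t a) (f a) (x a) := by
  refine Measurable.ite (measurableSet_le measurable_const ht) (Measurable.mul ?_ ?_)
    measurable_const
  · exact ENNReal.measurable_ofReal.comp
      (Real.measurable_exp.comp (M.measurable_Lam.comp (hx.prodMk ht)).neg)
  · exact hf.comp (measurable_id.prodMk (M.measurable_flow.comp (ht.real_toNNReal.prodMk hx)))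

lemma measurable_killed_right (M : PDMPModel Y I) (t : ℝ) {f : Y × I → ℝ≥0∞}
    (hf : Measurable f) : Measurable (M.killed t f) :=
  M.measurable_killed measurable_const (f := fun _ => f) (hf.comp measurable_snd) measurable_id

lemma measurable_jumpRate (M : PDMPModel Y I) {α : Type*} [MeasurableSpace α]
    {f : α → Y × I → ℝ≥0∞} {x : α → Y × I}
    (hf : Measurable (Function.uncurry f)) (hx : Measurable x) :
    Measurable fun a => M.jumpRate (f a) (x a) := by
  refine (ENNReal.measurable_ofReal.comp (M.continuous_lam.measurable.comp hx.fst)).mul ?_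
  exact Measurable.lintegral_kernel_prod_right' (κ := M.W.comap x hx) hf

lemma Lam_add (M : PDMPModel Y I) (x : Y × I) {s t : ℝ} (hs : 0 ≤ s) (ht : 0 ≤ t) :
    M.Lam x (s + t) = M.Lam x s + M.Lam (M.flow s.toNNReal x) t := by
  have hc := M.continuous_lam_flow x
  unfold Lam
  rw [← intervalIntegral.integral_add_adjacent_intervals (hc.intervalIntegrable 0 s)
    (hc.intervalIntegrable s (s + t))]
  congr 1
  have h := intervalIntegral.integral_comp_add_left (a := 0) (b := t)
    (fun h : ℝ => M.lam (M.S x.2 h.toNNReal x.1)) s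
  rw [add_zero] at h
  rw [← h]
  refine intervalIntegral.integral_congr fun r hr => ?_
  rw [uIcc_of_le ht] at hr
  simp only [flow, M.S_add]
  rw [← Real.toNNReal_add hr.1 hs, add_comm]

lemma flow_flow (M : PDMPModel Y I) (s t : ℝ≥0) (x : Y × I) :
    M.flow t (M.flow s x) = M.flow (s + t) x := by
  simp only [flow, M.S_add, add_comm]

/-- The cocycle identity for Λ makes the survival factors multiply. Both times must be nonnegative
because of the extension by 0. -/
lemma killed_killed (M : PDMPModel Y I) {s t : ℝ} (hs : 0 ≤ s) (ht : 0 ≤ t)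
    (f : Y × I → ℝ≥0∞) (x : Y × I) : M.killed s (M.killed t f) x = M.killed (s + t) f x := by
  simp only [killed, if_pos hs, if_pos ht, if_pos (add_nonneg hs ht), M.Lam_add x hs ht,
    M.flow_flow, Real.toNNReal_add hs ht, neg_add, Real.exp_add,
    ENNReal.ofReal_mul (Real.exp_pos _).le, mul_assoc]

lemma killed_of_neg (M : PDMPModel Y I) {t : ℝ} (ht : t < 0) (f : Y × I → ℝ≥0∞) :
    M.killed t f = 0 := by
  ext x; simp [killed, ht]

lemma mul_le_Lam (M : PDMPModel Y I) {a : ℝ} (ha : ∀ y, a ≤ M.lam y) (x : Y × I) {t : ℝ}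
    (ht : 0 ≤ t) : a * t ≤ M.Lam x t := by
  have := intervalIntegral.integral_mono_on ht
    (intervalIntegrable_const (c := a) (μ := volume))
    ((M.continuous_lam_flow x).intervalIntegrable 0 t) (fun s _ => ha _)
  rwa [intervalIntegral.integral_const, sub_zero, smul_eq_mul, mul_comm] at this

/-- The indicator carries the extension by 0, so the bound can be integrated over all of ℝ. It
yields both the finiteness of the potential and the decay as t → ∞. -/
lemma killed_le (M : PDMPModel Y I) {a : ℝ} (ha : ∀ y, a ≤ M.lam y) {f : Y × I → ℝ≥0∞}
    {c : ℝ≥0∞} (hf : ∀ x, f x ≤ c) (t : ℝ) (x : Y × I) :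
    M.killed t f x ≤
      (Ici (0 : ℝ)).indicator (fun t => ENNReal.ofReal (Real.exp (-(a * t)))) t * c := by
  by_cases ht : 0 ≤ t
  · rw [indicator_of_mem (by exact ht), killed, if_pos ht]
    exact mul_le_mul' (ENNReal.ofReal_le_ofReal (Real.exp_le_exp.2
      (neg_le_neg (M.mul_le_Lam ha x ht)))) (hf _)
  · simp [killed, ht]

lemma lintegral_exp_neg_mul {a : ℝ} (ha : 0 < a) :
    ∫⁻ t, (Ici (0 : ℝ)).indicator (fun t => ENNReal.ofReal (Real.exp (-(a * t)))) t =
      ENNReal.ofReal a⁻¹ := by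
  rw [lintegral_indicator measurableSet_Ici, setLIntegral_congr Ioi_ae_eq_Ici.symm]
  have h := integral_exp_mul_Ioi (neg_neg_of_pos ha) 0
  have hi := integrableOn_exp_mul_Ioi (neg_neg_of_pos ha) 0
  have h2 := ofReal_integral_eq_lintegral_ofReal hi
    (Filter.Eventually.of_forall fun _ => (Real.exp_pos _).le)
  rw [h] at h2
  simp only [neg_mul] at h2
  rw [← h2]
  simp [neg_div_neg_eq]

/-- The density of the waiting time beyond `u` integrates to the survival probability. -/
lemma lintegral_waitDensity_Ioi (M : PDMPModel Y I) (x : Y × I) {u : ℝ} (hu : 0 ≤ u) :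
    ∫⁻ t in Ioi u, M.waitDensity x t = ENNReal.ofReal (Real.exp (-M.Lam x u)) := by
  have h0 := M.lintegral_waitDensity (M.flow u.toNNReal x)
  have hw : ∀ t ∈ Ioi (0 : ℝ), M.waitDensity x (u + t) =
      ENNReal.ofReal (Real.exp (-M.Lam x u)) * M.waitDensity (M.flow u.toNNReal x) t := by
    intro t ht
    rw [waitDensity, waitDensity, M.Lam_add x hu (le_of_lt ht), neg_add, Real.exp_add,
      ← ENNReal.ofReal_mul (Real.exp_pos _).le]
    simp only [flow, M.S_add]
    rw [Real.toNNReal_add hu (le_of_lt ht), add_comm t.toNNReal]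
    congr 1
    ring
  have h1 : ∫⁻ t in Ioi u, M.waitDensity x t = ∫⁻ t in Ioi (0 : ℝ), M.waitDensity x (u + t) := by
    rw [← lintegral_indicator measurableSet_Ioi, ← lintegral_indicator measurableSet_Ioi,
      ← lintegral_add_left_eq_self _ u]
    refine lintegral_congr fun t => ?_
    simp [indicator]
  rw [h1, setLIntegral_congr_fun measurableSet_Ioi hw, lintegral_const_mul, h0, mul_one]
  exact M.measurable_waitDensity.comp measurable_prodMk_left

/-! ### Integration against the kernels and the path law -/

lemma lintegral_wait (M : PDMPModel Y I) (x : Y × I) {f : ℝ≥0 → ℝ≥0∞} (hf : Measurable f) :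
    ∫⁻ t, f t ∂(M.wait x) = ∫⁻ t in Ioi (0 : ℝ), M.waitDensity x t * f t.toNNReal := by
  rw [wait, Kernel.lintegral_map _ measurable_real_toNNReal _ hf, Kernel.lintegral_withDensity _
    M.measurable_waitDensity _ (by exact hf.comp measurable_real_toNNReal), Kernel.const_apply]

/-- The waiting density splits: exp(-Λ) goes into `killed`, while λ, evaluated at the pre-jump
point, goes into `jumpRate`. Since `killed` vanishes at negative times, t ranges over ℝ, which makes
later translations free of boundary terms. -/
lemma lintegral_barP (M : PDMPModel Y I) (x : Y × I) (s : ℝ≥0) {F : (Y × I) × ℝ≥0 → ℝ≥0∞}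
    (hF : Measurable F) :
    ∫⁻ q, F q ∂(M.barP (x, s)) =
      ∫⁻ t, M.killed t (M.jumpRate fun z => F (z, s + t.toNNReal)) x := by
  have hg : Measurable fun r : ℝ≥0 × (ℝ≥0 × (Y × I)) => (r.2.2, r.1 + r.2.1) := by fun_prop
  have hF' : Measurable fun r : ℝ≥0 × (ℝ≥0 × (Y × I)) => F (r.2.2, r.1 + r.2.1) := hF.comp hg
  have hF2 : Measurable fun r : ℝ≥0 × (Y × I) => F (r.2, s + r.1) :=
    hF.comp (f := fun r : ℝ≥0 × (Y × I) => (r.2, s + r.1)) (by fun_prop)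
  have hK : Measurable fun t : ℝ≥0 => ∫⁻ z, F (z, s + t) ∂(M.W (M.flow t x)) :=
    Measurable.lintegral_kernel_prod_right' (κ := M.W.comap (fun t : ℝ≥0 =>
      M.flow t x) (M.measurable_flow.comp measurable_prodMk_right)) hF2
  rw [barP, Kernel.lintegral_map _ hg _ hF, Kernel.lintegral_prod _ _ _ hF',
    Kernel.lintegral_deterministic' _ (by exact Measurable.lintegral_prod_right' hF'),
    Kernel.comap_apply, step, Kernel.lintegral_compProd _ _ _ hF2]
  simp only [Kernel.comap_apply]
  rw [M.lintegral_wait x hK, setLIntegral_congr Ioi_ae_eq_Ici,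
    ← lintegral_indicator measurableSet_Ici]
  refine lintegral_congr fun t => ?_
  by_cases ht : 0 ≤ t
  · rw [indicator_of_mem (by exact ht), killed, if_pos ht, jumpRate, waitDensity,
      ENNReal.ofReal_mul (M.lam_pos _).le, ← mul_assoc,
      mul_comm (ENNReal.ofReal (Real.exp _))]
    rfl
  · simp [killed, ht]

/-- This is the factorisation P = G λW, with G written as a time integral. -/
lemma lintegral_P (M : PDMPModel Y I) (x : Y × I) {f : Y × I → ℝ≥0∞} (hf : Measurable f) :
    ∫⁻ z, f z ∂(M.P x) = ∫⁻ t, M.killed t (M.jumpRate f) x := by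
  rw [P, Kernel.lintegral_map _ measurable_fst _ hf, Kernel.comap_apply,
    M.lintegral_barP _ _ (F := fun q => f q.1) (hf.comp measurable_fst)]

/-- The potential kernel of the killed flow. -/
def potential (M : PDMPModel Y I) : Kernel (Y × I) (Y × I) :=
  (Kernel.id ×ₖ ((Kernel.const (Y × I) (volume.restrict (Ici (0 : ℝ)))).withDensity
    fun x t => ENNReal.ofReal (Real.exp (-M.Lam x t)))).map fun p => M.flow p.2.toNNReal p.1

lemma lintegral_potential (M : PDMPModel Y I) (x : Y × I) {f : Y × I → ℝ≥0∞}
    (hf : Measurable f) : ∫⁻ z, f z ∂(M.potential x) = ∫⁻ t, M.killed t f x := by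
  have hfl : Measurable fun p : (Y × I) × ℝ => M.flow p.2.toNNReal p.1 :=
    M.measurable_flow.comp (measurable_snd.real_toNNReal.prodMk measurable_fst)
  have he : Measurable (Function.uncurry fun (x : Y × I) t =>
      ENNReal.ofReal (Real.exp (-M.Lam x t))) :=
    ENNReal.measurable_ofReal.comp (Real.measurable_exp.comp M.measurable_Lam.neg)
  have := Kernel.IsSFiniteKernel.withDensity (Kernel.const (Y × I) (volume.restrict (Ici (0 : ℝ))))
    (f := fun x t => ENNReal.ofReal (Real.exp (-M.Lam x t))) fun _ _ => ENNReal.ofReal_ne_top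
  rw [potential, Kernel.lintegral_map _ hfl _ hf, Kernel.lintegral_id_prod
      (f := fun p : (Y × I) × ℝ => f (M.flow p.2.toNNReal p.1)) (hf.comp hfl),
    Kernel.lintegral_withDensity _ he _ (by exact (hf.comp hfl).comp measurable_prodMk_left),
    Kernel.const_apply, ← lintegral_indicator measurableSet_Ici]
  refine lintegral_congr fun t => ?_
  by_cases ht : 0 ≤ t <;> simp [killed, ht]

lemma lintegral_pathLaw_zero (M : PDMPModel Y I) (x : Y × I) {F : (Y × I) × ℝ≥0 → ℝ≥0∞}
    (hF : Measurable F) : ∫⁻ ω, F (ω 0) ∂(M.pathLaw x) = F (x, 0) := by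
  rw [pathLaw, Kernel.comap_apply, Kernel.lintegral_traj (X := fun _ => (Y × I) × ℝ≥0) _
    (f := fun ω => F (ω 0)) (hF.comp (measurable_pi_apply 0))]
  simp [Function.updateFinset]

/-- The Markov property of the chain, for two consecutive coordinates. -/
lemma lintegral_pathLaw_succ (M : PDMPModel Y I) (x : Y × I) (n : ℕ)
    {F : ((Y × I) × ℝ≥0) × ((Y × I) × ℝ≥0) → ℝ≥0∞} (hF : Measurable F) :
    ∫⁻ ω, F (ω n, ω (n + 1)) ∂(M.pathLaw x) =
      ∫⁻ ω, ∫⁻ q, F (ω n, q) ∂(M.barP (ω n)) ∂(M.pathLaw x) := by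
  have hn : Measurable fun h : (Finset.Iic n → (Y × I) × ℝ≥0) =>
      h ⟨n, Finset.mem_Iic.2 le_rfl⟩ := measurable_pi_apply _
  have hG : Measurable fun r : (Finset.Iic n → (Y × I) × ℝ≥0) × ((Y × I) × ℝ≥0) =>
      F (r.1 ⟨n, Finset.mem_Iic.2 le_rfl⟩, r.2) :=
    hF.comp ((hn.comp measurable_fst).prodMk measurable_snd)
  have hH : Measurable fun h : (Finset.Iic n → (Y × I) × ℝ≥0) =>
      ∫⁻ q, F (h ⟨n, Finset.mem_Iic.2 le_rfl⟩, q) ∂(M.barP (h ⟨n, Finset.mem_Iic.2 le_rfl⟩)) :=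
    Measurable.lintegral_kernel_prod_right' (κ := M.barP.comap _ hn) hG
  -- The joint law of the history up to `n` and of coordinate `n + 1` is the law of the history
  -- composed with one step of the chain.
  have key := Kernel.partialTraj_compProd_eq_map_traj (X := fun _ => (Y × I) × ℝ≥0)
    (κ := fun n => M.barP.comap (fun h : (Finset.Iic n → (Y × I) × ℝ≥0) =>
      h ⟨n, Finset.mem_Iic.2 le_rfl⟩) (measurable_pi_apply _)) (Nat.zero_le n)
    (x₀ := fun _ => (x, (0 : ℝ≥0)))
  have h1 := congrArg (fun μ => ∫⁻ r, F (r.1 ⟨n, Finset.mem_Iic.2 le_rfl⟩, r.2) ∂μ) key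
  rw [lintegral_map hG ((Preorder.measurable_frestrictLe n).prodMk (measurable_pi_apply _)),
    Measure.lintegral_compProd hG] at h1
  simp only [Kernel.comap_apply] at h1
  rw [← Kernel.traj_map_frestrictLe_apply,
    lintegral_map hH (Preorder.measurable_frestrictLe n)] at h1
  exact h1.symm

/-! ### Expansion of the semigroup by the number of jumps -/

/-- The part of the semigroup carried by the event that exactly `n` jumps occur before `t`. -/
def nJumps (M : PDMPModel Y I) (n : ℕ) (t : ℝ) (f : Y × I → ℝ≥0∞) (x : Y × I) : ℝ≥0∞ :=
  ∫⁻ ω, M.killed (t - (ω n).2) f (ω n).1 ∂(M.pathLaw x)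

lemma measurable_killed_path (M : PDMPModel Y I) {α : Type*} [MeasurableSpace α] (n : ℕ)
    {t : α → ℝ} {f : α → Y × I → ℝ≥0∞} {ω : α → ℕ → (Y × I) × ℝ≥0} (ht : Measurable t)
    (hf : Measurable (Function.uncurry f)) (hω : Measurable ω) :
    Measurable fun a => M.killed (t a - (ω a n).2) (f a) (ω a n).1 := by
  have h := (measurable_pi_apply n).comp hω
  exact M.measurable_killed (ht.sub h.snd.coe_nnreal_real) hf h.fst

lemma measurable_nJumps (M : PDMPModel Y I) {α : Type*} [MeasurableSpace α] (n : ℕ) {t : α → ℝ}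
    {f : α → Y × I → ℝ≥0∞} {x : α → Y × I} (ht : Measurable t)
    (hf : Measurable (Function.uncurry f)) (hx : Measurable x) :
    Measurable fun a => M.nJumps n (t a) (f a) (x a) := by
  refine Measurable.lintegral_kernel_prod_right' (κ := M.pathLaw.comap x hx)
    (f := fun p : α × (ℕ → (Y × I) × ℝ≥0) =>
      M.killed (t p.1 - (p.2 n).2) (f p.1) (p.2 n).1) ?_
  exact M.measurable_killed_path n (ht.comp measurable_fst)
    (f := fun p : α × (ℕ → (Y × I) × ℝ≥0) => f p.1)
    (hf.comp (measurable_fst.fst.prodMk measurable_snd)) measurable_snd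

lemma nJumps_zero (M : PDMPModel Y I) (t : ℝ) {f : Y × I → ℝ≥0∞} (hf : Measurable f)
    (x : Y × I) : M.nJumps 0 t f x = M.killed t f x := by
  rw [nJumps, M.lintegral_pathLaw_zero x (F := fun q => M.killed (t - q.2) f q.1)
    (M.measurable_killed (f := fun _ => f) (by fun_prop) (hf.comp measurable_snd) measurable_fst)]
  simp

lemma nJumps_of_neg (M : PDMPModel Y I) (n : ℕ) {t : ℝ} (ht : t < 0) (f : Y × I → ℝ≥0∞)
    (x : Y × I) : M.nJumps n t f x = 0 := by
  have h : ∀ s : ℝ≥0, t - s < 0 := fun s => by linarith [s.coe_nonneg]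
  simp [nJumps, M.killed_of_neg (h _)]

lemma measurable_jumpRate_killed (M : PDMPModel Y I) (t : ℝ) {f : Y × I → ℝ≥0∞}
    (hf : Measurable f) :
    Measurable fun p : ℝ × (Y × I) => M.jumpRate (M.killed (t - p.1) f) p.2 := by
  refine M.measurable_jumpRate (f := fun p : ℝ × (Y × I) => M.killed (t - p.1) f) ?_ measurable_snd
  exact M.measurable_killed (t := fun q : (ℝ × (Y × I)) × (Y × I) => t - q.1.1)
    (f := fun _ => f) (by fun_prop) (hf.comp measurable_snd) measurable_snd

/-- Decomposition at the last jump. -/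
lemma nJumps_succ (M : PDMPModel Y I) (n : ℕ) (t : ℝ) {f : Y × I → ℝ≥0∞} (hf : Measurable f)
    (x : Y × I) :
    M.nJumps (n + 1) t f x = ∫⁻ v, M.nJumps n v (M.jumpRate (M.killed (t - v) f)) x := by
  have hF : Measurable fun q : (Y × I) × ℝ≥0 => M.killed (t - q.2) f q.1 :=
    M.measurable_killed (f := fun _ => f) (by fun_prop) (hf.comp measurable_snd) measurable_fst
  have hm : Measurable fun p : (ℕ → (Y × I) × ℝ≥0) × ℝ =>
      M.killed (p.2 - (p.1 n).2) (M.jumpRate (M.killed (t - p.2) f)) (p.1 n).1 :=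
    M.measurable_killed_path n measurable_snd
      (f := fun p : (ℕ → (Y × I) × ℝ≥0) × ℝ => M.jumpRate (M.killed (t - p.2) f))
      ((M.measurable_jumpRate_killed t hf).comp (measurable_fst.snd.prodMk measurable_snd))
      measurable_fst
  simp only [nJumps]
  rw [M.lintegral_pathLaw_succ x n (F := fun p => M.killed (t - p.2.2) f p.2.1)
    (hF.comp measurable_snd), lintegral_lintegral_swap
    (f := fun v (ω : ℕ → (Y × I) × ℝ≥0) =>
      M.killed (v - (ω n).2) (M.jumpRate (M.killed (t - v) f)) (ω n).1)
    (hm.comp measurable_swap).aemeasurable]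
  refine lintegral_congr fun ω => ?_
  simp only
  -- The waiting time is replaced by the absolute time `v` of jump `n + 1`; for `v` before jump `n`
  -- both integrands vanish.
  rw [M.lintegral_barP (ω n).1 (ω n).2 hF, ← lintegral_sub_right_eq_self _ ((ω n).2 : ℝ)]
  refine lintegral_congr fun v => ?_
  by_cases hv : v - (ω n).2 < 0
  · simp [M.killed_of_neg hv]
  · simp only [NNReal.coe_add, Real.coe_toNNReal _ (not_lt.1 hv), add_sub_cancel]

lemma ae_monotone (M : PDMPModel Y I) (x : Y × I) :
    ∀ᵐ ω ∂(M.pathLaw x), Monotone fun n => (ω n).2 := by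
  have h : ∀ n, ∀ᵐ ω ∂(M.pathLaw x), (ω n).2 ≤ (ω (n + 1)).2 := fun n => by
    have hm : MeasurableSet {p : ((Y × I) × ℝ≥0) × ((Y × I) × ℝ≥0) | p.1.2 ≤ p.2.2}ᶜ :=
      (measurableSet_le (by fun_prop) (by fun_prop)).compl
    have hi : Measurable ({p : ((Y × I) × ℝ≥0) × ((Y × I) × ℝ≥0) | p.1.2 ≤ p.2.2}ᶜ.indicator
        (fun _ => (1 : ℝ≥0∞))) := measurable_const.indicator hm
    have h0 := M.lintegral_pathLaw_succ x n hi
    have hz : ∀ q : (Y × I) × ℝ≥0, ∫⁻ q', ({p : ((Y × I) × ℝ≥0) × ((Y × I) × ℝ≥0) |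
        p.1.2 ≤ p.2.2}ᶜ.indicator (fun _ => (1 : ℝ≥0∞))) (q, q') ∂(M.barP q) = 0 := by
      rintro ⟨z, s⟩
      rw [M.lintegral_barP z s (by exact hi.comp measurable_prodMk_left)]
      simp [indicator, jumpRate, killed]
    simp only [hz, lintegral_zero] at h0
    have hp : Measurable fun ω : ℕ → (Y × I) × ℝ≥0 => (ω n, ω (n + 1)) := by fun_prop
    filter_upwards [(lintegral_eq_zero_iff (hi.comp hp)).1 h0] with ω hω
    by_contra hc
    simp [indicator, not_le.1 hc] at hω
  filter_upwards [ae_all_iff.2 h] with ω hω using monotone_nat_of_le_succ hω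

lemma jumpRate_le (M : PDMPModel Y I) {b : ℝ} (hb : ∀ y, M.lam y ≤ b) {f : Y × I → ℝ≥0∞}
    {c : ℝ≥0∞} (hf : ∀ x, f x ≤ c) (x : Y × I) : M.jumpRate f x ≤ ENNReal.ofReal b * c := by
  refine mul_le_mul' (ENNReal.ofReal_le_ofReal (hb _)) ((lintegral_mono hf).trans ?_)
  simp

/-- Each wait contributes to the Laplace transform of the n-th jump time a factor at most ∫₀^∞ b
exp(-(a+b)t) dt = b/(a+b). Taking the upper bound `b` as the Laplace parameter makes this less than
1. -/
lemma lintegral_exp_path_le (M : PDMPModel Y I) {a b : ℝ} (ha : 0 < a) (hb : 0 ≤ b)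
    (hla : ∀ y, a ≤ M.lam y) (hlb : ∀ y, M.lam y ≤ b) (x : Y × I) (n : ℕ) :
    ∫⁻ ω, ENNReal.ofReal (Real.exp (-(b * (ω n).2))) ∂(M.pathLaw x) ≤
      ENNReal.ofReal (b * (a + b)⁻¹) ^ n := by
  have hF : Measurable fun q : (Y × I) × ℝ≥0 => ENNReal.ofReal (Real.exp (-(b * q.2))) := by
    fun_prop
  induction n with
  | zero => rw [M.lintegral_pathLaw_zero x hF]; simp
  | succ n ih =>
    rw [M.lintegral_pathLaw_succ x n (F := fun p => ENNReal.ofReal (Real.exp (-(b * p.2.2))))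
      (hF.comp measurable_snd), pow_succ']
    refine le_trans ?_ (mul_le_mul_right ih _)
    rw [← lintegral_const_mul _ (by fun_prop)]
    refine lintegral_mono fun ω => ?_
    simp only
    rw [M.lintegral_barP (ω n).1 (ω n).2 hF]
    have hbd : ∀ t : ℝ, M.killed t (M.jumpRate fun _ => ENNReal.ofReal
        (Real.exp (-(b * ((ω n).2 + t.toNNReal : ℝ≥0))))) (ω n).1 ≤
        (ENNReal.ofReal b * ENNReal.ofReal (Real.exp (-(b * (ω n).2)))) *
        (Ici (0 : ℝ)).indicator (fun t => ENNReal.ofReal (Real.exp (-((a + b) * t)))) t := by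
      intro t
      refine (M.killed_le hla (M.jumpRate_le hlb fun _ => le_rfl) t _).trans ?_
      by_cases ht : 0 ≤ t
      · rw [indicator_of_mem (by exact ht), indicator_of_mem (by exact ht), NNReal.coe_add,
          Real.coe_toNNReal _ ht, ← ENNReal.ofReal_mul hb, ← ENNReal.ofReal_mul hb,
          ← ENNReal.ofReal_mul (Real.exp_pos _).le, ← ENNReal.ofReal_mul (by positivity)]
        refine ENNReal.ofReal_le_ofReal (le_of_eq ?_)
        rw [mul_assoc, ← Real.exp_add, mul_left_comm, ← Real.exp_add]
        congr 2
        ring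
      · rw [indicator_of_notMem (by exact ht)]; simp
    refine (lintegral_mono hbd).trans (le_of_eq ?_)
    rw [lintegral_const_mul _ (Measurable.indicator (by fun_prop) measurableSet_Ici),
      lintegral_exp_neg_mul (by linarith), ENNReal.ofReal_mul hb, mul_right_comm]

lemma lam_bounds [Nonempty Y] (M : PDMPModel Y I) :
    ∃ a b : ℝ, 0 < a ∧ 0 < b ∧ (∀ y, a ≤ M.lam y) ∧ ∀ y, M.lam y ≤ b := by
  obtain ⟨a, ha, hla⟩ := M.lam_lower
  obtain ⟨b, hlb⟩ := M.lam_upper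
  exact ⟨a, b, ha, (M.lam_pos (Classical.arbitrary Y)).trans_le (hlb _), hla, hlb⟩

/-- The jump times are almost surely unbounded. -/
lemma ae_exists_lt (M : PDMPModel Y I) (x : Y × I) (t : ℝ≥0) :
    ∀ᵐ ω ∂(M.pathLaw x), ∃ n, t < (ω n).2 := by
  have : Nonempty Y := ⟨x.1⟩
  obtain ⟨a, b, ha, hb, hla, hlb⟩ := M.lam_bounds
  have hq : ENNReal.ofReal (b * (a + b)⁻¹) < 1 := by
    rw [ENNReal.ofReal_lt_one, ← div_eq_mul_inv, div_lt_one (by positivity)]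
    linarith
  have hlim : Filter.Tendsto (fun n : ℕ => ENNReal.ofReal (Real.exp (b * t)) *
      ENNReal.ofReal (b * (a + b)⁻¹) ^ n) Filter.atTop (nhds 0) := by
    have := ENNReal.Tendsto.const_mul (a := ENNReal.ofReal (Real.exp (b * t)))
      (ENNReal.tendsto_pow_atTop_nhds_zero_of_lt_one hq) (Or.inr ENNReal.ofReal_ne_top)
    simpa using this
  rw [ae_iff]
  -- Chernoff bound: the exceptional event lies in {τ_n ≤ t} for every `n`, of probability at most
  -- exp(bt) E exp(-bτ_n).
  refine le_antisymm (ge_of_tendsto' hlim fun n => ?_) zero_le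
  have hset : MeasurableSet {ω : ℕ → (Y × I) × ℝ≥0 | (ω n).2 ≤ t} :=
    measurableSet_le (by fun_prop) measurable_const
  refine (measure_mono (t := {ω | (ω n).2 ≤ t}) fun ω hω => ?_).trans ?_
  · simp only [not_exists, not_lt] at hω
    exact hω n
  · refine le_trans ?_ (mul_le_mul_right (M.lintegral_exp_path_le ha hb.le hla hlb x n) _)
    rw [← lintegral_const_mul _ (by fun_prop), ← lintegral_indicator_one hset]
    refine lintegral_mono fun ω => ?_
    by_cases hω : (ω n).2 ≤ t
    · rw [indicator_of_mem (by exact hω), ← ENNReal.ofReal_mul (Real.exp_pos _).le,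
        ← Real.exp_add, Pi.one_apply, ENNReal.one_le_ofReal, Real.one_le_exp_iff]
      have : ((ω n).2 : ℝ) ≤ t := hω
      nlinarith
    · rw [indicator_of_notMem (by exact hω)]; exact zero_le

lemma measure_barP_lt (M : PDMPModel Y I) (z : Y × I) {s t : ℝ≥0} (hst : s ≤ t) :
    M.barP (z, s) {q | t < q.2} = ENNReal.ofReal (Real.exp (-M.Lam z (t - s))) := by
  have hu : (0 : ℝ) ≤ t - s := sub_nonneg.2 hst
  have hm : MeasurableSet {q : (Y × I) × ℝ≥0 | t < q.2} :=
    measurableSet_lt measurable_const measurable_snd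
  rw [← lintegral_indicator_one hm, M.lintegral_barP z s (measurable_one.indicator hm),
    ← M.lintegral_waitDensity_Ioi z hu, ← lintegral_indicator measurableSet_Ioi]
  refine lintegral_congr fun r => ?_
  by_cases hr : 0 ≤ r
  · have h : t < s + r.toNNReal ↔ (t : ℝ) - s < r := by
      rw [← NNReal.coe_lt_coe, NNReal.coe_add, Real.coe_toNNReal _ hr, sub_lt_iff_lt_add']
    by_cases hr' : (t : ℝ) - s < r
    · simp only [killed, jumpRate, indicator, mem_ofPred_eq, h, hr', mem_Ioi, hr, if_true,
        Pi.one_apply, lintegral_one, measure_univ, mul_one, waitDensity]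
      rw [mul_comm, ← ENNReal.ofReal_mul (M.lam_pos _).le]
      rfl
    · simp [killed, jumpRate, indicator, h, hr']
  · have : r ∉ Ioi ((t : ℝ) - s) := fun h => hr (hu.trans (le_of_lt h))
    simp [killed, hr, this]

/-- The semigroup is the sum over the number of jumps. -/
lemma lintegral_semigroup (M : PDMPModel Y I) (t : ℝ≥0) {f : Y × I → ℝ≥0∞} (hf : Measurable f)
    (x : Y × I) : ∫⁻ z, f z ∂(M.semigroup t x) = ∑' n, M.nJumps n t f x := by
  classical
  -- On consecutive coordinates `G` is f(Ψ(t)) restricted to τ_n ≤ t < τ_{n+1}. Integrating out the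
  -- later coordinate turns the condition t < τ_{n+1} into the survival factor of `killed`.
  set G : ((Y × I) × ℝ≥0) × ((Y × I) × ℝ≥0) → ℝ≥0∞ := fun p =>
    {p : ((Y × I) × ℝ≥0) × ((Y × I) × ℝ≥0) | p.1.2 ≤ t ∧ t < p.2.2}.indicator
      (fun p => f (M.flow (t - p.1.2) p.1.1)) p with hG
  have hGm : Measurable G := by
    refine Measurable.indicator ?_ ((measurableSet_le (by fun_prop) measurable_const).inter
      (measurableSet_lt measurable_const (by fun_prop)))
    exact hf.comp (M.measurable_flow.comp ((measurable_const.sub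
      measurable_fst.snd).prodMk measurable_fst.fst))
  have hterm : ∀ n, M.nJumps n t f x = ∫⁻ ω, G (ω n, ω (n + 1)) ∂(M.pathLaw x) := fun n => by
    rw [M.lintegral_pathLaw_succ x n hGm]
    refine lintegral_congr fun ω => ?_
    by_cases hs : (ω n).2 ≤ t
    · have hs' : (0 : ℝ) ≤ t - (ω n).2 := sub_nonneg.2 hs
      have : ∀ q, G (ω n, q) = f (M.flow (t - (ω n).2) (ω n).1) *
          {q : (Y × I) × ℝ≥0 | t < q.2}.indicator 1 q := fun q => by
        simp [hG, indicator, hs]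
      have hm : MeasurableSet {q : (Y × I) × ℝ≥0 | t < q.2} :=
        measurableSet_lt measurable_const measurable_snd
      simp only [this]
      rw [lintegral_const_mul _ (measurable_one.indicator hm), lintegral_indicator_one hm,
        M.measure_barP_lt (ω n).1 hs, killed, if_pos hs', mul_comm]
      rw [← NNReal.coe_sub hs, Real.toNNReal_coe]
    · have hs' : (t : ℝ) - (ω n).2 < 0 := sub_neg.2 (not_le.1 hs)
      simp [hG, hs, M.killed_of_neg hs']
  rw [semigroup, Kernel.lintegral_map _ (M.measurable_Psi t) _ hf]
  simp only [hterm]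
  rw [← lintegral_tsum (f := fun n (ω : ℕ → (Y × I) × ℝ≥0) => G (ω n, ω (n + 1)))
    fun n => (hGm.comp (by fun_prop)).aemeasurable]
  have h0 : ∀ᵐ ω ∂(M.pathLaw x), (ω 0).2 = 0 := by
    have hi : Measurable fun q : (Y × I) × ℝ≥0 => (q.2 : ℝ≥0∞) := by fun_prop
    have h := M.lintegral_pathLaw_zero x hi
    rw [ENNReal.coe_zero, lintegral_eq_zero_iff (by fun_prop)] at h
    filter_upwards [h] with ω hω
    simpa using hω
  refine lintegral_congr_ae ?_
  filter_upwards [h0, M.ae_monotone x, M.ae_exists_lt x t] with ω h0 hmono hex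
  -- The first index whose jump time exceeds `t` is positive because τ_0 = 0; its predecessor is the
  -- required index.
  have hE : ∃ n, (ω n).2 ≤ t ∧ t < (ω (n + 1)).2 := by
    obtain ⟨k, hk⟩ : ∃ k, Nat.find hex = k + 1 := Nat.exists_eq_succ_of_ne_zero fun h => by
      have := Nat.find_spec hex
      rw [h, h0] at this
      exact not_lt_bot this
    exact ⟨k, not_lt.1 (Nat.find_min hex (by omega)), hk ▸ Nat.find_spec hex⟩
  have huniq : ∀ n, ((ω n).2 ≤ t ∧ t < (ω (n + 1)).2) → n = Nat.find hE := fun n hn => by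
    have h' := Nat.find_spec hE
    exact le_antisymm (not_lt.1 fun h => not_lt.2 hn.1 (h'.2.trans_le (hmono h)))
      (Nat.find_min' hE hn)
  have hzero : ∀ n ≠ Nat.find hE, G (ω n, ω (n + 1)) = 0 := fun n hn =>
    indicator_of_notMem (by exact fun h => hn (huniq n h)) _
  have hfind : G (ω (Nat.find hE), ω (Nat.find hE + 1)) =
      f (M.flow (t - (ω (Nat.find hE)).2) (ω (Nat.find hE)).1) :=
    indicator_of_mem (by exact Nat.find_spec hE) _
  rw [tsum_eq_single _ hzero, hfind, Psi, dif_pos hE]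

/-! ### The two maps between measures -/

/-- The measure of post-jump locations produced per unit of time from the distribution `μ`. -/
def jumpMeasure (M : PDMPModel Y I) (μ : Measure (Y × I)) : Measure (Y × I) :=
  (μ.withDensity fun x => ENNReal.ofReal (M.lam x.1)).bind M.W

lemma lintegral_jumpMeasure (M : PDMPModel Y I) (μ : Measure (Y × I)) {f : Y × I → ℝ≥0∞}
    (hf : Measurable f) : ∫⁻ z, f z ∂(M.jumpMeasure μ) = ∫⁻ x, M.jumpRate f x ∂μ := by
  have hl : Measurable fun x : Y × I => ENNReal.ofReal (M.lam x.1) :=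
    ENNReal.measurable_ofReal.comp (M.continuous_lam.measurable.comp measurable_fst)
  rw [jumpMeasure, Measure.lintegral_bind M.W.aemeasurable hf.aemeasurable,
    lintegral_withDensity_eq_lintegral_mul _ hl hf.lintegral_kernel]
  rfl

lemma lintegral_bind_potential (M : PDMPModel Y I) (ν : Measure (Y × I)) {f : Y × I → ℝ≥0∞}
    (hf : Measurable f) :
    ∫⁻ z, f z ∂(ν.bind M.potential) = ∫⁻ x, (∫⁻ t, M.killed t f x) ∂ν := by
  rw [Measure.lintegral_bind M.potential.aemeasurable hf.aemeasurable]
  simp only [M.lintegral_potential _ hf]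

lemma lintegral_bind_P (M : PDMPModel Y I) (ν : Measure (Y × I)) {f : Y × I → ℝ≥0∞}
    (hf : Measurable f) :
    ∫⁻ z, f z ∂(ν.bind M.P) = ∫⁻ x, (∫⁻ t, M.killed t (M.jumpRate f) x) ∂ν := by
  rw [Measure.lintegral_bind M.P.aemeasurable hf.aemeasurable]
  simp only [M.lintegral_P _ hf]

lemma measurable_jumpRate_right (M : PDMPModel Y I) {f : Y × I → ℝ≥0∞} (hf : Measurable f) :
    Measurable (M.jumpRate f) :=
  M.measurable_jumpRate (f := fun _ => f) (hf.comp measurable_snd) measurable_id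

/-- The factorisation P = G λW acting on measures; it links the two maps for every ν. -/
lemma jumpMeasure_bind_potential (M : PDMPModel Y I) (ν : Measure (Y × I)) :
    M.jumpMeasure (ν.bind M.potential) = ν.bind M.P := by
  refine Measure.ext_of_lintegral _ fun f hf => ?_
  rw [M.lintegral_jumpMeasure _ hf, M.lintegral_bind_potential _ (M.measurable_jumpRate_right hf),
    M.lintegral_bind_P _ hf]

/-! ### The balance equation and invariance -/

/-- Decomposition of `μ` by the last jump before time `t`, when a process with transition
semigroup `semigroup` is in equilibrium at `μ`. -/
def IsBalanced (M : PDMPModel Y I) (μ : Measure (Y × I)) : Prop :=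
  ∀ t : ℝ, 0 ≤ t → ∀ f : Y × I → ℝ≥0∞, Measurable f → ∫⁻ x, f x ∂μ =
    ∫⁻ x, M.killed t f x ∂μ + ∫⁻ v in Ici 0, ∫⁻ x, M.jumpRate (M.killed (t - v) f) x ∂μ

lemma measurable_killed_time (M : PDMPModel Y I) {f : Y × I → ℝ≥0∞} (hf : Measurable f) :
    Measurable fun p : (Y × I) × ℝ => M.killed p.2 f p.1 :=
  M.measurable_killed (f := fun _ => f) measurable_snd (hf.comp measurable_snd) measurable_fst

/-- Substitute w = t - v. The range v ≥ 0 becomes w ≤ t, and negative w contribute nothing. -/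
lemma lintegral_jumpRate_killed_eq (M : PDMPModel Y I) (μ : Measure (Y × I)) (t : ℝ)
    {f : Y × I → ℝ≥0∞} (hf : Measurable f) :
    ∫⁻ v in Ici 0, ∫⁻ x, M.jumpRate (M.killed (t - v) f) x ∂μ =
      ∫⁻ w in Iic t, ∫⁻ x, M.killed w f x ∂(M.jumpMeasure μ) := by
  rw [← lintegral_indicator measurableSet_Ici, ← lintegral_indicator measurableSet_Iic,
    ← lintegral_sub_left_eq_self _ t]
  refine lintegral_congr fun v => ?_
  by_cases hv : v ≤ t
  · rw [indicator_of_mem (by simpa using hv), indicator_of_mem (by simpa using hv),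
      M.lintegral_jumpMeasure _ (M.measurable_killed_right _ hf), sub_sub_cancel]
  · rw [indicator_of_notMem (by simpa using hv), indicator_of_notMem (by simpa using hv)]

/-- Invariance gives νGλW = ν, so balance reduces to splitting ∫ νK_w f dw at w = t; the tail is νG
K_t f by the semigroup law. -/
lemma isBalanced_bind_potential (M : PDMPModel Y I) {ν : Measure (Y × I)} [SFinite ν]
    (hν : M.P.Invariant ν) : M.IsBalanced (ν.bind M.potential) := by
  intro t ht f hf
  have hk := M.measurable_killed_time hf
  have h1 : ∀ x, ∫⁻ s, M.killed s (M.killed t f) x = ∫⁻ w in Ioi t, M.killed w f x := fun x => by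
    rw [setLIntegral_congr Ioi_ae_eq_Ici, ← lintegral_indicator measurableSet_Ici,
      ← lintegral_sub_right_eq_self _ t]
    refine lintegral_congr fun w => ?_
    by_cases hw : t ≤ w
    · rw [indicator_of_mem (by exact hw), M.killed_killed (sub_nonneg.2 hw) ht, sub_add_cancel]
    · rw [indicator_of_notMem (by exact hw), M.killed_of_neg (sub_neg.2 (not_le.1 hw))]
      rfl
  rw [M.lintegral_jumpRate_killed_eq _ t hf, M.jumpMeasure_bind_potential, hν.def,
    M.lintegral_bind_potential _ hf,
    M.lintegral_bind_potential _ (M.measurable_killed_right t hf),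
    lintegral_lintegral_swap (f := fun w x => M.killed w f x)
      (hk.comp measurable_swap).aemeasurable]
  simp only [h1]
  rw [← lintegral_add_right _ (Measurable.lintegral_prod_right' hk)]
  refine lintegral_congr fun x => ?_
  rw [add_comm, ← compl_Iic, lintegral_add_compl _ measurableSet_Iic]

lemma lintegral_nJumps_succ (M : PDMPModel Y I) (μ : Measure (Y × I)) [SFinite μ] (n : ℕ) (t : ℝ)
    {f : Y × I → ℝ≥0∞} (hf : Measurable f) :
    ∫⁻ x, M.nJumps (n + 1) t f x ∂μ =
      ∫⁻ v in Ici 0, ∫⁻ x, M.nJumps n v (M.jumpRate (M.killed (t - v) f)) x ∂μ := by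
  have hm : Measurable fun p : (Y × I) × ℝ =>
      M.nJumps n p.2 (M.jumpRate (M.killed (t - p.2) f)) p.1 :=
    M.measurable_nJumps n measurable_snd
      (f := fun p : (Y × I) × ℝ => M.jumpRate (M.killed (t - p.2) f))
      ((M.measurable_jumpRate_killed t hf).comp (measurable_fst.snd.prodMk measurable_snd))
      measurable_fst
  simp only [M.nJumps_succ n t hf]
  rw [lintegral_lintegral_swap
    (f := fun x v => M.nJumps n v (M.jumpRate (M.killed (t - v) f)) x) hm.aemeasurable,
    ← lintegral_indicator measurableSet_Ici]
  refine lintegral_congr fun v => ?_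
  by_cases hv : 0 ≤ v
  · rw [indicator_of_mem (by exact hv)]
  · rw [indicator_of_notMem (by exact hv)]
    simp [M.nJumps_of_neg n (not_le.1 hv)]

lemma measurable_jumpRate_killed_right (M : PDMPModel Y I) (t : ℝ) {f : Y × I → ℝ≥0∞}
    (hf : Measurable f) : Measurable (M.jumpRate (M.killed t f)) :=
  M.measurable_jumpRate_right (M.measurable_killed_right t hf)

lemma measurable_lintegral_nJumps (M : PDMPModel Y I) (μ : Measure (Y × I)) [SFinite μ] (n : ℕ)
    (t : ℝ) {f : Y × I → ℝ≥0∞} (hf : Measurable f) :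
    Measurable fun v => ∫⁻ x, M.nJumps n v (M.jumpRate (M.killed (t - v) f)) x ∂μ := by
  refine Measurable.lintegral_prod_right'
    (f := fun p : ℝ × (Y × I) => M.nJumps n p.1 (M.jumpRate (M.killed (t - p.1) f)) p.2) ?_
  exact M.measurable_nJumps n measurable_fst
    (f := fun p : ℝ × (Y × I) => M.jumpRate (M.killed (t - p.1) f))
    ((M.measurable_jumpRate_killed t hf).comp (measurable_fst.fst.prodMk measurable_snd))
    measurable_snd

/-- Induction for all times and functions at once: removing the last jump, at time v, leaves at most
n - 1 jumps for the function λW K_{t-v} f. The induction hypothesis bounds that part, and balance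
reassembles the bound. -/
lemma IsBalanced.sum_nJumps_le {M : PDMPModel Y I} {μ : Measure (Y × I)} [SFinite μ]
    (hμ : M.IsBalanced μ) (n : ℕ) {t : ℝ} (ht : 0 ≤ t) {f : Y × I → ℝ≥0∞} (hf : Measurable f) :
    ∑ k ∈ Finset.range n, ∫⁻ x, M.nJumps k t f x ∂μ ≤ ∫⁻ x, f x ∂μ := by
  induction n generalizing t f with
  | zero => simp
  | succ n ih =>
    rw [Finset.sum_range_succ', hμ t ht f hf, add_comm]
    simp only [M.nJumps_zero t hf, M.lintegral_nJumps_succ μ _ t hf]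
    gcongr
    rw [← lintegral_finsetSum _ fun k _ => M.measurable_lintegral_nJumps μ k t hf]
    exact setLIntegral_mono' measurableSet_Ici fun v hv =>
      ih hv (M.measurable_jumpRate_killed_right _ hf)

lemma lintegral_bind_semigroup (M : PDMPModel Y I) (μ : Measure (Y × I)) (t : ℝ≥0)
    {f : Y × I → ℝ≥0∞} (hf : Measurable f) :
    ∫⁻ x, f x ∂(μ.bind (M.semigroup t)) = ∑' n, ∫⁻ x, M.nJumps n t f x ∂μ := by
  rw [Measure.lintegral_bind (M.semigroup t).aemeasurable hf.aemeasurable]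
  simp only [M.lintegral_semigroup t hf]
  exact lintegral_tsum fun n => (M.measurable_nJumps n measurable_const (f := fun _ => f)
    (hf.comp measurable_snd) measurable_id).aemeasurable

/-- The partial sums give only μP_t ≤ μ; as P_t is Markov and μ is finite, equal total masses
upgrade this to equality. -/
lemma IsBalanced.invariant {M : PDMPModel Y I} {μ : Measure (Y × I)} [IsFiniteMeasure μ]
    (hμ : M.IsBalanced μ) (t : ℝ≥0) : (M.semigroup t).Invariant μ := by
  have hle : μ.bind (M.semigroup t) ≤ μ := Measure.le_iff.2 fun A hA => by
    rw [← lintegral_indicator_one hA, ← lintegral_indicator_one hA,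
      M.lintegral_bind_semigroup μ t (measurable_one.indicator hA)]
    exact ENNReal.tsum_le_of_sum_range_le fun n =>
      hμ.sum_nJumps_le n t.2 (measurable_one.indicator hA)
  refine Measure.eq_of_le_of_measure_univ_eq hle ?_
  rw [Measure.bind_apply MeasurableSet.univ (M.semigroup t).aemeasurable]
  simp

/-- The no-jump term is μK_t f. In the other terms, summing over the jumps before the last one
rebuilds μP_v, which is μ. -/
lemma isBalanced_of_invariant {M : PDMPModel Y I} {μ : Measure (Y × I)} [SFinite μ]
    (hμ : ∀ t : ℝ≥0, (M.semigroup t).Invariant μ) : M.IsBalanced μ := by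
  have h : ∀ t : ℝ, 0 ≤ t → ∀ f : Y × I → ℝ≥0∞, Measurable f →
      ∑' n, ∫⁻ x, M.nJumps n t f x ∂μ = ∫⁻ x, f x ∂μ := fun t ht f hf => by
    have := M.lintegral_bind_semigroup μ t.toNNReal hf
    rw [(hμ t.toNNReal).def, Real.coe_toNNReal _ ht] at this
    exact this.symm
  intro t ht f hf
  rw [← h t ht f hf, tsum_eq_zero_add' ENNReal.summable]
  simp only [M.nJumps_zero t hf, M.lintegral_nJumps_succ μ _ t hf]
  rw [← lintegral_tsum fun n => (M.measurable_lintegral_nJumps μ n t hf).aemeasurable]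
  congr 1
  exact setLIntegral_congr_fun measurableSet_Ici fun v hv =>
    h v hv _ (M.measurable_jumpRate_killed_right _ hf)

/-- Let t → ∞ in the balance equation: the killed term is at most exp(-at) μ(X), and the integral
over w ≤ t exhausts the potential. -/
lemma IsBalanced.bind_potential_jumpMeasure [Nonempty Y] {M : PDMPModel Y I}
    {μ : Measure (Y × I)} [IsFiniteMeasure μ] [SFinite (M.jumpMeasure μ)] (hμ : M.IsBalanced μ) :
    (M.jumpMeasure μ).bind M.potential = μ := by
  obtain ⟨a, b, ha, -, hla, -⟩ := M.lam_bounds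
  ext A hA
  have hf : Measurable (A.indicator (1 : Y × I → ℝ≥0∞)) := measurable_one.indicator hA
  have hk := M.measurable_killed_time hf
  rw [← lintegral_indicator_one hA, ← lintegral_indicator_one hA, M.lintegral_bind_potential _ hf,
    lintegral_lintegral_swap (f := fun x w => M.killed w _ x) hk.aemeasurable]
  have h1 : Filter.Tendsto (fun t : ℝ => ∫⁻ x, M.killed t (A.indicator 1) x ∂μ)
      Filter.atTop (nhds 0) := by
    have hlim : Filter.Tendsto (fun t : ℝ => ENNReal.ofReal (Real.exp (-(a * t))) * μ univ)
        Filter.atTop (nhds 0) := by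
      have h0 : Filter.Tendsto (fun t : ℝ => ENNReal.ofReal (Real.exp (-(a * t))))
          Filter.atTop (nhds 0) := by
        rw [← ENNReal.ofReal_zero]
        exact ENNReal.tendsto_ofReal (Real.tendsto_exp_neg_atTop_nhds_zero.comp
          (Filter.tendsto_id.const_mul_atTop ha))
      simpa using ENNReal.Tendsto.mul_const h0 (Or.inr (measure_ne_top μ univ))
    refine tendsto_of_tendsto_of_tendsto_of_le_of_le tendsto_const_nhds hlim
      (fun _ => zero_le) fun t => ?_
    refine (lintegral_mono fun x => M.killed_le hla (c := 1)
      (indicator_le_self' (fun _ _ => zero_le)) t x).trans ?_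
    rw [lintegral_const, mul_one]
    gcongr
    exact indicator_le_self' (fun _ _ => zero_le) t
  have h2 := (aecover_Iic (μ := volume) (Filter.tendsto_id (α := ℝ))
    ).lintegral_tendsto_of_countably_generated
    (f := fun w => ∫⁻ x, M.killed w (A.indicator 1) x ∂(M.jumpMeasure μ))
    (Measurable.lintegral_prod_left' hk).aemeasurable
  have h3 := h1.add h2
  rw [zero_add] at h3
  -- By balance the sum of the two terms is constant in `t ≥ 0`, so its limit is that constant.
  refine tendsto_nhds_unique h3 (tendsto_const_nhds.congr' ?_)
  filter_upwards [Filter.eventually_ge_atTop 0] with t ht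
  rw [hμ t ht _ hf, M.lintegral_jumpRate_killed_eq μ t hf]
  rfl

lemma isFiniteMeasure_jumpMeasure (M : PDMPModel Y I) (μ : Measure (Y × I)) [IsFiniteMeasure μ] :
    IsFiniteMeasure (M.jumpMeasure μ) := by
  obtain ⟨b, hlb⟩ := M.lam_upper
  refine ⟨?_⟩
  rw [← lintegral_one, M.lintegral_jumpMeasure _ measurable_const]
  refine (lintegral_mono (M.jumpRate_le hlb fun _ => le_rfl)).trans_lt ?_
  rw [lintegral_const]
  exact ENNReal.mul_lt_top (ENNReal.mul_lt_top ENNReal.ofReal_lt_top ENNReal.one_lt_top)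
    (measure_lt_top _ _)

lemma isFiniteMeasure_bind_potential (M : PDMPModel Y I) (ν : Measure (Y × I))
    [IsFiniteMeasure ν] : IsFiniteMeasure (ν.bind M.potential) := by
  obtain ⟨a, ha, hla⟩ := M.lam_lower
  refine ⟨?_⟩
  rw [← lintegral_one, M.lintegral_bind_potential _ measurable_const]
  refine (lintegral_mono fun x => lintegral_mono fun t =>
    M.killed_le hla (fun _ => le_rfl) t x).trans_lt ?_
  simp only [mul_one, lintegral_exp_neg_mul ha, lintegral_const]
  exact ENNReal.mul_lt_top ENNReal.ofReal_lt_top (measure_lt_top _ _)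

lemma invariant_smul {κ : Kernel (Y × I) (Y × I)} {μ : Measure (Y × I)} (h : κ.Invariant μ)
    (c : ℝ≥0∞) : κ.Invariant (c • μ) := by
  rw [Kernel.Invariant, Measure.bind_smul, h.def]

end PDMPModel

end

/-! ### The correspondence of invariant measures -/

theorem corollary4p7 {Y I : Type*}
    [MetricSpace Y] [CompleteSpace Y] [SecondCountableTopology Y] [Nonempty Y]
    [MeasurableSpace Y] [BorelSpace Y]
    [Fintype I] [Nonempty I] [MeasurableSpace I] [DiscreteMeasurableSpace I]
    (M : PDMPModel Y I) (hJ : M.JointFeller) :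
    (∃! μ : Measure (Y × I), IsProbabilityMeasure μ ∧ ∀ t : ℝ≥0, (M.semigroup t).Invariant μ) ↔
      (∃! μ : Measure (Y × I), IsProbabilityMeasure μ ∧ M.P.Invariant μ) := by
  have hF : ∀ (c : ℝ≥0∞) (μ : Measure (Y × I)), M.jumpMeasure (c • μ) = c • M.jumpMeasure μ :=
    fun c μ => by
      rw [PDMPModel.jumpMeasure, withDensity_smul_measure, Measure.bind_smul]
      rfl
  have hG : ∀ (c : ℝ≥0∞) (ν : Measure (Y × I)),
      (c • ν).bind M.potential = c • ν.bind M.potential := fun c ν => Measure.bind_smul _ _ _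
  have hsemi : ∀ (c : ℝ≥0∞) (μ : Measure (Y × I)), (∀ t, (M.semigroup t).Invariant μ) →
      ∀ t, (M.semigroup t).Invariant (c • μ) := fun c μ h t => PDMPModel.invariant_smul (h t) c
  have hP : ∀ (c : ℝ≥0∞) (ν : Measure (Y × I)), M.P.Invariant ν → M.P.Invariant (c • ν) :=
    fun c ν h => PDMPModel.invariant_smul h c
  have hpF : ∀ μ : Measure (Y × I), IsFiniteMeasure μ → (∀ t, (M.semigroup t).Invariant μ) →
      IsFiniteMeasure (M.jumpMeasure μ) ∧ M.P.Invariant (M.jumpMeasure μ) ∧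
        (M.jumpMeasure μ).bind M.potential = μ := fun μ _ h => by
    have hfin := M.isFiniteMeasure_jumpMeasure μ
    have hμ := (PDMPModel.isBalanced_of_invariant h).bind_potential_jumpMeasure
    refine ⟨hfin, ?_, hμ⟩
    -- (μλW)P = ((μλW)G)λW = μλW.
    rw [Kernel.Invariant, ← M.jumpMeasure_bind_potential, hμ]
  have hqG : ∀ ν : Measure (Y × I), IsFiniteMeasure ν → M.P.Invariant ν →
      IsFiniteMeasure (ν.bind M.potential) ∧
        (∀ t, (M.semigroup t).Invariant (ν.bind M.potential)) ∧
        M.jumpMeasure (ν.bind M.potential) = ν := fun ν _ h => by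
    have hfin := M.isFiniteMeasure_bind_potential ν
    refine ⟨hfin, (M.isBalanced_bind_potential h).invariant, ?_⟩
    rw [M.jumpMeasure_bind_potential, h.def]
  -- The correspondence is symmetric, so the converse follows by exchanging the two maps.
  exact ⟨existsUnique_isProbabilityMeasure_of_correspondence hP hsemi hF hG hpF hqG,
    existsUnique_isProbabilityMeasure_of_correspondence hsemi hP hG hF hqG hpF⟩
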